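/- A hybrid dynamical system $H=(D,F,G,R)$ consists of a finite disjoint union $D=\coprod_{j\in J}D_j$ of connected smooth manifolds with boundary (of possibly different dimensions $\dim D_j\ge 1$), a smooth vector field $F$ on $D$, an open subset $G\subset\partial D$ (the guard) and a smooth map $R:G\to D$ (the reset map). An execution is a right-continuous map $x:T\to D$ on an interval $T\subset\mathbb R$ such that $\dot x(t)=F(x(t))$ at every $t\in T$ where $x$ is continuous, and such that at every $t\in T$ where $x$ is discontinuous the left limit $x(t^-)$ exists, lies in $G$, and satisfies $R(x(t^-))=x(t)$. Assume that $F$ is outward-pointing on $G$, and let $\gamma:\mathbb R\to D$ be a periodic execution with a least positive period, with finitely many discontinuities per period. We write $\gamma$ also for the set of all values and left limits of $\gamma$. Let $\Sigma\subset D$ be an embedded codimension-one submanifold without boundary of one of the components that meets $\gamma$ in exactly one point $\xi$, let $U\subset\Sigma$ be an open neighborhood of $\xi$, and let $P:U\to\Sigma$ be a Poincaré map for $\gamma$, i.e. a smooth map that sends each $x\in U$ to the point where an execution started at $x$ first returns to $\Sigma$ (with $\gamma$ as the execution through $\xi$, so that $P(\xi)=\xi$). Here an execution started at a point $x\in G$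 has initial value $R(x)$, and meets $\Sigma$ where one of its values or left limits lies in $\Sigma$. Let $P^k$ denote the $k$-th iterate of $P$, defined where the first $k$ points of the orbit lie in $U$, and put $m=\min_{j\in J}\dim D_j$. **Corollary.** Let $k,r\in\mathbb N$ with $k\le m$, and let $W\subset U$ be a neighborhood of $\xi$ on which $P^k$ is defined. Suppose that $\operatorname{rank}DP^k(x)=r$ for all $x\in W$ and that $\operatorname{rank}DP^{k+1}(\xi)=\operatorname{rank}DP^k(\xi)$. Then there is an open neighborhood $V\subset W$ of $\xi$ on which $P^m$ is defined and $\operatorname{rank}DP^m(x)=r$ for all $x\in V$. Consequently the hypotheses of the Exact Reduction theorem, namely that $\gamma$ is a periodic orbit with isolated transitions of $H$ (with $F$ outward-pointing on $G$), that $P$ is a Poincaré map for $\gamma$, and that $\operatorname{rank}DP^m$ is constant, equal to some $r'$, on a neighborhood of $\xi$ in $U$, are satisfied with $r'=\operatorname{rank}DP^k(\xi)$. -/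

import Mathlib

open Set Filter Topology Manifold
open scoped ContDiff

universe u v w

/-- A smooth hybrid manifold: a finite disjoint union of connected smooth manifolds with boundary
`Dom j`, of possibly different dimensions `dim j ≥ 1`. -/
structure HybridManifold where
  J : Type u
  finite_J : Finite J
  dim : J → ℕ
  dim_ne_zero : ∀ j, NeZero (dim j)
  Dom : J → Type v
  top : ∀ j, TopologicalSpace (Dom j)
  charted : ∀ j, ChartedSpace (EuclideanHalfSpace (dim j)) (Dom j)
  smooth : ∀ j, IsManifold (𝓡∂ (dim j)) ∞ (Dom j)
  hausdorff : ∀ j, T2Space (Dom j)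
  secondCountable : ∀ j, SecondCountableTopology (Dom j)
  connected : ∀ j, ConnectedSpace (Dom j)

namespace HybridManifold

attribute [instance] finite_J dim_ne_zero top charted smooth hausdorff secondCountable connected

/-- The points of the disjoint union, with the disjoint union topology. -/
abbrev Pt (D : HybridManifold.{u, v}) : Type (max u v) := Σ j, D.Dom j

/-- The least dimension of the components (used only when there is at least one component). -/
noncomputable def minDim (D : HybridManifold.{u, v}) : ℕ := ⨅ j, D.dim j

end HybridManifold

/-- A hybrid dynamical system `(D, F, G, R)` on the hybrid manifold `D`. The guard `G` is given by
its parts `G j` in the components. The reset map `R` is a total function, of which only the values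
on the guard matter. -/
structure HybridDynamicalSystem (D : HybridManifold.{u, v}) where
  /-- the vector field -/
  F : ∀ j, ∀ x : D.Dom j, TangentSpace (𝓡∂ (D.dim j)) x
  F_smooth : ∀ j, ContMDiff (𝓡∂ (D.dim j)) (𝓡∂ (D.dim j)).tangent ∞
    (fun x => (⟨x, F j x⟩ : TangentBundle (𝓡∂ (D.dim j)) (D.Dom j)))
  /-- the guard, an open subset of the boundary -/
  G : ∀ j, Set (D.Dom j)
  G_open : ∀ j, ∃ O : Set (D.Dom j), IsOpen O ∧ G j = O ∩ (𝓡∂ (D.dim j)).boundary (D.Dom j)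
  /-- the reset map -/
  R : D.Pt → D.Pt
  /-- near each point of the guard, the reset map takes values in a single component, and is
  smooth along the guard -/
  R_smooth : ∀ j, ∀ x ∈ G j, ∃ l, ∃ f : D.Dom j → D.Dom l,
    ContMDiffWithinAt (𝓡∂ (D.dim j)) (𝓡∂ (D.dim l)) ∞ f (G j) x ∧
      ∀ᶠ y in 𝓝[G j] x, R ⟨j, y⟩ = ⟨l, f y⟩

namespace HybridDynamicalSystem

variable {D : HybridManifold.{u, v}}

/-- The guard as a subset of the disjoint union. -/
def guard (H : HybridDynamicalSystem D) : Set D.Pt := {p | p.2 ∈ H.G p.1}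

/-- `F` is (strictly) outward-pointing on the guard: in the half-space chart `{y | 0 ≤ y 0}` at
each point of the guard, the component of `F` with index `0` is negative. -/
def OutwardOnGuard (H : HybridDynamicalSystem D) : Prop :=
  ∀ j, ∀ x ∈ H.G j,
    let v : EuclideanSpace ℝ (Fin (D.dim j)) :=
      mfderiv (𝓡∂ (D.dim j)) 𝓘(ℝ, EuclideanSpace ℝ (Fin (D.dim j)))
        (extChartAt (𝓡∂ (D.dim j)) x) x (H.F j x)
    v 0 < 0

/-- `x`, restricted to `T`, is differentiable at `t` with derivative `F (x t)`
(one-sided at the end points of the interval `T`). -/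
def FollowsFieldAt (H : HybridDynamicalSystem D) (T : Set ℝ) (x : ℝ → D.Pt) (t : ℝ) : Prop :=
  ∃ (j : D.J) (c : ℝ → D.Dom j), (∀ᶠ s in 𝓝[T] t, x s = ⟨j, c s⟩) ∧
    HasMFDerivWithinAt 𝓘(ℝ, ℝ) (𝓡∂ (D.dim j)) c T t
      ((1 : ℝ →L[ℝ] ℝ).smulRight (H.F j (c t)))

/-- `x`, restricted to the interval `T`, is an execution of `H`. Values of `x` off `T` are
irrelevant. -/
structure IsExecution (H : HybridDynamicalSystem D) (T : Set ℝ) (x : ℝ → D.Pt) : Prop where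
  interval : T.OrdConnected
  rightContinuous : ∀ t ∈ T, ContinuousWithinAt x (T ∩ Ici t) t
  flow : ∀ t ∈ T, ContinuousWithinAt x T t → H.FollowsFieldAt T x t
  jump : ∀ t ∈ T, ¬ ContinuousWithinAt x T t →
    ∃ p ∈ H.guard, Tendsto x (𝓝[T ∩ Iio t] t) (𝓝 p) ∧ H.R p = x t

/-- `γ : ℝ → D` is a periodic orbit with period `τ`, the least positive period. In particular
`γ` is not constant. -/
structure IsPeriodicOrbit (H : HybridDynamicalSystem D) (γ : ℝ → D.Pt) (τ : ℝ) : Prop where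
  execution : H.IsExecution univ γ
  period : IsLeast {s : ℝ | 0 < s ∧ Function.Periodic γ s} τ

/-- The periodic orbit `γ` of period `τ` undergoes isolated discrete transitions: finitely many
of them in each period. -/
def IsolatedTransitions (γ : ℝ → D.Pt) (τ : ℝ) : Prop :=
  {t ∈ Ico 0 τ | ¬ ContinuousAt γ t}.Finite

/-- The function `x` on `T` passes through the point `p` at time `t`: `p` is its value `x t`, or
the left limit at `t`. (At a transition, the exit point in the guard is the left limit.) -/
def PassesThrough (T : Set ℝ) (x : ℝ → D.Pt) (t : ℝ) (p : D.Pt) : Prop :=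
  t ∈ T ∧ (x t = p ∨ ((𝓝[T ∩ Iio t] t).NeBot ∧ Tendsto x (𝓝[T ∩ Iio t] t) (𝓝 p)))

/-- The orbit as a subset of the hybrid manifold: all points that `γ` passes through, exit points
in the guard included. -/
def orbit (γ : ℝ → D.Pt) : Set D.Pt := {p | ∃ t, PassesThrough univ γ t p}

/-- `x` is an execution on `[0, σ]` with initial point `p` (if `p` lies in the guard, the reset
map is applied to obtain the initial value), and it meets `Sec` at positive times for the first
time at time `σ`, at the point `q`. -/
structure FirstHit (H : HybridDynamicalSystem D) (Sec : Set D.Pt) (x : ℝ → D.Pt) (σ : ℝ)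
    (p q : D.Pt) : Prop where
  pos : 0 < σ
  execution : H.IsExecution (Icc 0 σ) x
  start : x 0 = p ∨ (p ∈ H.guard ∧ x 0 = H.R p)
  mem : q ∈ Sec
  hit : PassesThrough (Icc 0 σ) x σ q
  first : ∀ t ∈ Ioo 0 σ, ∀ q' ∈ Sec, ¬ PassesThrough (Icc 0 σ) x t q'

end HybridDynamicalSystem

section Section

variable {D : HybridManifold.{u, v}} {j : D.J} {S : Type w} [TopologicalSpace S]
  [ChartedSpace (EuclideanSpace ℝ (Fin (D.dim j - 1))) S]

/-- `ι : S → D_j` presents the smooth manifold `S` (without boundary, of dimension `dim D_j - 1`)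
as an embedded submanifold of codimension one: it is smooth, it has injective differentials, and
it is a topological embedding. -/
structure IsCodimOneEmbedding (ι : S → D.Dom j) : Prop where
  smooth : ContMDiff (𝓡 (D.dim j - 1)) (𝓡∂ (D.dim j)) ∞ ι
  immersion : ∀ s, Function.Injective (mfderiv (𝓡 (D.dim j - 1)) (𝓡∂ (D.dim j)) ι s)
  embedding : IsEmbedding ι

/-- The submanifold parametrized by `ι`, as a subset of the disjoint union. -/
def sectionSet (ι : S → D.Dom j) : Set D.Pt := range (fun s => (⟨j, ι s⟩ : D.Pt))

/-- `P : U → Σ` is a Poincaré map for the periodic orbit `γ`, where `Σ` is the embedded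
submanifold `ι : S → D_j`, `U` is an open subset of it and `ξ` the only point of `Σ` on the orbit.
The map `P` is a total function on `S`, of which only the values on `U` matter: it is smooth on
`U`, and `P s` is the point where an execution started at `s` first returns to `Σ`; the
execution traced from `ξ` may be taken to be `γ` itself. -/
structure IsPoincareMap (H : HybridDynamicalSystem D) (γ : ℝ → D.Pt) (ι : S → D.Dom j)
    (U : Set S) (P : S → S) (ξ : S) : Prop where
  codimOne : IsCodimOneEmbedding ι
  isOpen : IsOpen U
  mem : ξ ∈ U
  inter : HybridDynamicalSystem.orbit γ ∩ sectionSet ι = {⟨j, ι ξ⟩}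
  smooth : ContMDiffOn (𝓡 (D.dim j - 1)) (𝓡 (D.dim j - 1)) ∞ P U
  returns : ∀ s ∈ U, ∃ x σ, H.FirstHit (sectionSet ι) x σ ⟨j, ι s⟩ ⟨j, ι (P s)⟩
  returns_orbit : ∃ t₀ σ,
    H.FirstHit (sectionSet ι) (fun t => γ (t₀ + t)) σ ⟨j, ι ξ⟩ ⟨j, ι (P ξ)⟩

/-- The domain of the `k`-th iterate of the partial map `P : U → S`. -/
def iterDomain {S : Type w} (P : S → S) (U : Set S) (k : ℕ) : Set S :=
  {s | ∀ i < k, P^[i] s ∈ U}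

/-- The rank of the differential at `s` of the `k`-th iterate of `P`, for a map `P` on a manifold
without boundary of dimension `n`. -/
noncomputable def rankIter (n : ℕ) {S : Type w} [TopologicalSpace S]
    [ChartedSpace (EuclideanSpace ℝ (Fin n)) S] (P : S → S) (k : ℕ) (s : S) : ℕ :=
  Module.finrank ℝ (LinearMap.range (mfderiv (𝓡 n) (𝓡 n) (P^[k]) s).toLinearMap)

/-- The hypotheses of the exact reduction theorem, with rank `r`: `γ` is a periodic orbit with
isolated transitions of a hybrid dynamical system whose vector field is outward-pointing on the
guard, `P` is a Poincaré map for it, and `D(P^m)` has rank `r` on a neighborhood of the fixed point,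
where `m` is the least dimension of the components. -/
structure ExactReductionHypotheses (H : HybridDynamicalSystem D) (γ : ℝ → D.Pt) (τ : ℝ)
    (ι : S → D.Dom j) (U : Set S) (P : S → S) (ξ : S) (r : ℕ) : Prop where
  outward : H.OutwardOnGuard
  periodic : H.IsPeriodicOrbit γ τ
  isolated : HybridDynamicalSystem.IsolatedTransitions γ τ
  poincare : IsPoincareMap H γ ι U P ξ
  constantRank : ∃ V : Set S, IsOpen V ∧ ξ ∈ V ∧ V ⊆ U ∧ V ⊆ iterDomain P U D.minDim ∧
    ∀ s ∈ V, rankIter (D.dim j - 1) P D.minDim s = r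

end Section

/-! The hybrid structure enters only through the smoothness of `P` and `P ξ = ξ`
(`IsPoincareMap.map_eq`); the rest concerns a smooth map near a fixed point. With `A = DP(ξ)`, the
differential of `P^l` at `ξ` is `A ^ l`. Equal ranks of `A ^ k` and `A ^ (k + 1)` make the
decreasing chain of ranges stop at `k` (`Module.End.finrank_range_pow_eq`), so `DP^m(ξ)` has rank
`r`.

Near `ξ` the rank of `DP^m` is squeezed. It is at least `r` by lower semicontinuity of the rank, and
at most `r` because `P^m` factors through `P^k`, whose differential has rank `r` on `W`
(`ContMDiffOn.rankIter_anti`). -/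

open HybridDynamicalSystem in
/-- A Poincaré map fixes the point where its section meets the orbit. -/
theorem IsPoincareMap.map_eq {D : HybridManifold.{u, v}} {j : D.J} {S : Type w}
    [TopologicalSpace S] [ChartedSpace (EuclideanSpace ℝ (Fin (D.dim j - 1))) S]
    {H : HybridDynamicalSystem D} {γ : ℝ → D.Pt} {ι : S → D.Dom j} {U : Set S} {P : S → S} {ξ : S}
    (hP : IsPoincareMap H γ ι U P ξ) : P ξ = ξ := by
  obtain ⟨t₀, σ, h⟩ := hP.returns_orbit
  have hmem : (⟨j, ι (P ξ)⟩ : D.Pt) ∈ orbit γ := by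
    refine ⟨t₀ + σ, mem_univ _, ?_⟩
    rcases h.hit.2 with h' | ⟨-, h'⟩
    · exact Or.inl h'
    · refine Or.inr ⟨by rw [univ_inter]; infer_instance, ?_⟩
      -- The hit is a left limit taken inside `[0, σ]`. As `0 < σ`, it is a genuine left limit at
      -- `σ`, which translation by `t₀` carries to a left limit of `γ` at `t₀ + σ`.
      have hset : Icc 0 σ ∩ Iio σ = Ico 0 σ := by
        ext t; simp only [mem_inter_iff, mem_Icc, mem_Iio, mem_Ico]; grind
      rw [hset, nhdsWithin_Ico_eq_nhdsLT h.pos] at h'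
      rw [univ_inter]
      have hsub : Tendsto (fun t => t - t₀) (𝓝[<] (t₀ + σ)) (𝓝[<] σ) := by
        refine tendsto_nhdsWithin_of_tendsto_nhds_of_eventually_within _ ?_ ?_
        · have : Tendsto (fun t : ℝ => t - t₀) (𝓝 (t₀ + σ)) (𝓝 (t₀ + σ - t₀)) :=
            (continuous_id.sub continuous_const).tendsto _
          rw [add_sub_cancel_left] at this
          exact this.mono_left nhdsWithin_le_nhds
        · filter_upwards [self_mem_nhdsWithin] with t ht
          exact sub_lt_iff_lt_add'.2 (mem_Iio.1 ht)
      simpa [Function.comp_def] using h'.comp hsub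
  have hq : (⟨j, ι (P ξ)⟩ : D.Pt) ∈ orbit γ ∩ sectionSet ι := ⟨hmem, h.mem⟩
  rw [hP.inter, mem_singleton_iff] at hq
  exact hP.codimOne.embedding.injective (sigma_mk_injective hq)

/-- Once the ranks of two consecutive powers of an endomorphism agree, the rank is stationary. -/
theorem Module.End.finrank_range_pow_eq {K E : Type*} [Field K] [AddCommGroup E] [Module K E]
    [FiniteDimensional K E] (A : Module.End K E) {k m : ℕ} (hkm : k ≤ m)
    (h : Module.finrank K (LinearMap.range (A ^ (k + 1))) =
      Module.finrank K (LinearMap.range (A ^ k))) :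
    Module.finrank K (LinearMap.range (A ^ m)) = Module.finrank K (LinearMap.range (A ^ k)) := by
  have hrange : LinearMap.range (A ^ (k + 1)) = LinearMap.range (A ^ k) := by
    refine Submodule.eq_of_le_of_finrank_eq ?_ h
    rw [pow_succ]
    exact LinearMap.range_comp_le_range _ _
  suffices LinearMap.range (A ^ m) = LinearMap.range (A ^ k) by rw [this]
  induction m, hkm using Nat.le_induction with
  | base => rfl
  | succ m _ ih =>
    -- `range (A ^ (m + 1)) = A (range (A ^ m)) = A (range (A ^ k)) = range (A ^ (k + 1))`.
    rw [pow_succ', Module.End.mul_eq_comp, LinearMap.range_comp, ih, ← LinearMap.range_comp,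
      ← Module.End.mul_eq_comp, ← pow_succ', hrange]

theorem LinearMap.finrank_range_comp_le_right {K V V' V'' : Type*} [Field K]
    [AddCommGroup V] [Module K V] [AddCommGroup V'] [Module K V'] [AddCommGroup V''] [Module K V'']
    [FiniteDimensional K V'] (f : V' →ₗ[K] V'') (g : V →ₗ[K] V') :
    Module.finrank K (LinearMap.range (f ∘ₗ g)) ≤ Module.finrank K (LinearMap.range g) := by
  rw [LinearMap.range_comp]
  exact Submodule.finrank_map_le f _

theorem mem_iterDomain_of_map_eq {S : Type*} {P : S → S} {U : Set S} {ξ : S} (hξ : ξ ∈ U)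
    (hfix : P ξ = ξ) (k : ℕ) : ξ ∈ iterDomain P U k :=
  fun i _ => by rwa [Function.iterate_fixed hfix]

instance finiteDimensional_tangentSpace_euclidean {n : ℕ} {S : Type*} [TopologicalSpace S]
    [ChartedSpace (EuclideanSpace ℝ (Fin n)) S] (x : S) :
    FiniteDimensional ℝ (TangentSpace (𝓡 n) x) :=
  inferInstanceAs (FiniteDimensional ℝ (EuclideanSpace ℝ (Fin n)))

section Iterate

variable {n : ℕ} {S : Type*} [TopologicalSpace S] [ChartedSpace (EuclideanSpace ℝ (Fin n)) S]
  {P : S → S} {U : Set S} {ξ : S}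

theorem ContMDiffOn.contMDiffAt_iterate (hU : IsOpen U) (hP : ContMDiffOn (𝓡 n) (𝓡 n) ∞ P U)
    {k : ℕ} {s : S} (hs : s ∈ iterDomain P U k) : ContMDiffAt (𝓡 n) (𝓡 n) ∞ P^[k] s := by
  induction k with
  | zero => exact contMDiffAt_id
  | succ k ih =>
    rw [Function.iterate_succ']
    exact ((hP.contMDiffAt (hU.mem_nhds (hs k k.lt_succ_self))).comp s
      (ih fun i hi => hs i (hi.trans k.lt_succ_self)))

/-- Only finitely many conditions `P^[i] s ∈ U` are involved; each is open at `ξ`, since `P^[i]` is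
continuous there and fixes `ξ`. -/
theorem ContMDiffOn.iterDomain_mem_nhds (hU : IsOpen U) (hP : ContMDiffOn (𝓡 n) (𝓡 n) ∞ P U)
    (hξ : ξ ∈ U) (hfix : P ξ = ξ) (k : ℕ) : iterDomain P U k ∈ 𝓝 ξ := by
  have h : ∀ i ∈ Iio k, ∀ᶠ s in 𝓝 ξ, P^[i] s ∈ U := fun i _ => by
    refine (hP.contMDiffAt_iterate hU
      (mem_iterDomain_of_map_eq hξ hfix i)).continuousAt.eventually_mem (hU.mem_nhds ?_)
    rwa [Function.iterate_fixed hfix]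
  exact ((finite_Iio k).eventually_all.2 h)

/-- The differential of an iterate at a fixed point is the power of the differential. -/
theorem hasMFDerivAt_iterate_of_map_eq {A : EuclideanSpace ℝ (Fin n) →L[ℝ] EuclideanSpace ℝ (Fin n)}
    (hA : HasMFDerivAt (𝓡 n) (𝓡 n) P ξ A) (hfix : P ξ = ξ) (k : ℕ) :
    HasMFDerivAt (𝓡 n) (𝓡 n) P^[k] ξ (A ^ k) := by
  induction k with
  | zero => exact hasMFDerivAt_id ξ
  | succ k ih =>
    rw [Function.iterate_succ, pow_succ]
    have ih' : HasMFDerivAt (𝓡 n) (𝓡 n) P^[k] (P ξ) (A ^ k) := by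
      -- The base point also occurs in the type of the differential, so the rewrite is a dependent
      -- one.
      rw! [hfix]; exact ih
    exact ih'.comp ξ hA

theorem rankIter_eq_of_map_eq {A : EuclideanSpace ℝ (Fin n) →L[ℝ] EuclideanSpace ℝ (Fin n)}
    (hA : HasMFDerivAt (𝓡 n) (𝓡 n) P ξ A) (hfix : P ξ = ξ) (k : ℕ) :
    rankIter n P k ξ = Module.finrank ℝ
      (LinearMap.range ((A : Module.End ℝ (EuclideanSpace ℝ (Fin n))) ^ k)) := by
  have h : (mfderiv (𝓡 n) (𝓡 n) P^[k] ξ : EuclideanSpace ℝ (Fin n) →L[ℝ] _) = A ^ k :=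
    (hasMFDerivAt_iterate_of_map_eq hA hfix k).mfderiv
  unfold rankIter
  rw [← ContinuousLinearMap.toLinearMap_pow, ← h]
  rfl

/-- The rank of the differential does not increase along iterates. -/
theorem ContMDiffOn.rankIter_anti (hU : IsOpen U) (hP : ContMDiffOn (𝓡 n) (𝓡 n) ∞ P U)
    {k m : ℕ} (hkm : k ≤ m) {s : S} (hs : s ∈ iterDomain P U m) :
    rankIter n P m s ≤ rankIter n P k s := by
  obtain ⟨l, rfl⟩ := Nat.exists_eq_add_of_le' hkm
  have hk := (hP.contMDiffAt_iterate hU (k := k) (s := s)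
    fun i hi => hs i (by omega)).mdifferentiableAt (by simp)
  have hl := (hP.contMDiffAt_iterate hU (k := l) (s := P^[k] s) fun i hi => by
    rw [← Function.iterate_add_apply]; exact hs _ (by omega)).mdifferentiableAt (by simp)
  unfold rankIter
  rw [Function.iterate_add, mfderiv_comp s hl hk]
  exact LinearMap.finrank_range_comp_le_right _ _

end Iterate

/-- The rank of the differential of a smooth map is lower semicontinuous. -/
theorem ContMDiffAt.eventually_finrank_range_mfderiv_le {n : ℕ} {S : Type*} [TopologicalSpace S]
    [ChartedSpace (EuclideanSpace ℝ (Fin n)) S] [IsManifold (𝓡 n) ∞ S] {f : S → S} {x : S}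
    (hf : ContMDiffAt (𝓡 n) (𝓡 n) ∞ f x) :
    ∀ᶠ s in 𝓝 x, Module.finrank ℝ (LinearMap.range (mfderiv (𝓡 n) (𝓡 n) f x).toLinearMap) ≤
      Module.finrank ℝ (LinearMap.range (mfderiv (𝓡 n) (𝓡 n) f s).toLinearMap) := by
  have : IsManifold (𝓡 n) 1 S := IsManifold.of_le (n := ∞) (by simp)
  -- The differentials at different points act between different spaces; read in the trivializations
  -- at `x` and `f x`, they form a family in one fixed space, continuous at `x`.
  have hc := (hf.mfderiv_const (m := 0) (by simp)).continuousAt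
  have hself : (inTangentCoordinates (𝓡 n) (𝓡 n) id f (mfderiv (𝓡 n) (𝓡 n) f) x x :) =
      mfderiv (𝓡 n) (𝓡 n) f x := by
    refine (inTangentCoordinates_eq (I := 𝓡 n) (I' := 𝓡 n) id f (mfderiv (𝓡 n) (𝓡 n) f)
      (mem_chart_source _ _) (mem_chart_source _ _)).trans ?_
    refine ContinuousLinearMap.ext fun v => ?_
    refine ((tangentBundleCore (𝓡 n) S).coordChange_self _ _ (mem_chart_source _ _) _).trans ?_
    exact congrArg (mfderiv (𝓡 n) (𝓡 n) f x)
      ((tangentBundleCore (𝓡 n) S).coordChange_self _ _ (mem_chart_source _ x) v)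
  have hmem : inTangentCoordinates (𝓡 n) (𝓡 n) id f (mfderiv (𝓡 n) (𝓡 n) f) x x ∈
      {g : EuclideanSpace ℝ (Fin n) →L[ℝ] EuclideanSpace ℝ (Fin n) |
        ((Module.finrank ℝ (LinearMap.range (mfderiv (𝓡 n) (𝓡 n) f x).toLinearMap) : ℕ) :
          Cardinal) ≤ g.toLinearMap.rank} := by
    refine hself.symm ▸ ?_
    exact (Module.finrank_eq_rank ℝ (LinearMap.range (mfderiv (𝓡 n) (𝓡 n) f x).toLinearMap)).le
  -- Having rank at least a given number is an open condition.
  have hev := hc.eventually_mem ((isOpen_setOfPred_nat_le_rank (𝕜 := ℝ) _).mem_nhds hmem)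
  filter_upwards [hev, (chart_source_mem_nhds (EuclideanSpace ℝ (Fin n)) x),
    hf.continuousAt.eventually_mem (chart_source_mem_nhds (EuclideanSpace ℝ (Fin n)) (f x))]
    with s hs hsx hsf
  have hs' := hs.trans_eq (congrArg
    (fun g : EuclideanSpace ℝ (Fin n) →L[ℝ] EuclideanSpace ℝ (Fin n) => g.toLinearMap.rank)
    (inTangentCoordinates_eq_mfderiv_comp (I := 𝓡 n) (I' := 𝓡 n) (f := id)
      (ϕ := mfderiv (𝓡 n) (𝓡 n) f) hsx hsf))
  -- Composing with coordinate changes cannot raise the rank, so their invertibility is not needed.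
  have hs'' := hs'.trans ((LinearMap.rank_comp_le_right _ _).trans
    (LinearMap.rank_comp_le_left _ (mfderiv (𝓡 n) (𝓡 n) f s).toLinearMap))
  exact Nat.cast_le.1 (hs''.trans_eq (Module.finrank_eq_rank ℝ
    (LinearMap.range (mfderiv (𝓡 n) (𝓡 n) f s).toLinearMap)).symm)

theorem mainTheorem9 {D : HybridManifold.{u, v}} (H : HybridDynamicalSystem D)
    (hF : H.OutwardOnGuard)
    {γ : ℝ → D.Pt} {τ : ℝ} (hγ : H.IsPeriodicOrbit γ τ)
    (hiso : HybridDynamicalSystem.IsolatedTransitions γ τ)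
    {j : D.J} {S : Type w} [TopologicalSpace S]
    [ChartedSpace (EuclideanSpace ℝ (Fin (D.dim j - 1))) S]
    [IsManifold (𝓡 (D.dim j - 1)) ∞ S]
    {ι : S → D.Dom j} {U : Set S} {P : S → S} {ξ : S} (hP : IsPoincareMap H γ ι U P ξ)
    (k r : ℕ) (hk : k ≤ D.minDim)
    (W : Set S) (hW : W ∈ 𝓝 ξ) (hWU : W ⊆ U) (hWk : W ⊆ iterDomain P U k)
    (hrank : ∀ s ∈ W, rankIter (D.dim j - 1) P k s = r)
    (hstab : rankIter (D.dim j - 1) P (k + 1) ξ = rankIter (D.dim j - 1) P k ξ) :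
    (∃ V : Set S, IsOpen V ∧ ξ ∈ V ∧ V ⊆ W ∧ V ⊆ iterDomain P U D.minDim ∧
      ∀ s ∈ V, rankIter (D.dim j - 1) P D.minDim s = r) ∧
    ExactReductionHypotheses H γ τ ι U P ξ (rankIter (D.dim j - 1) P k ξ) := by
  have hfix := hP.map_eq
  have hdom : ∀ l, iterDomain P U l ∈ 𝓝 ξ :=
    hP.smooth.iterDomain_mem_nhds hP.isOpen hP.mem hfix
  obtain ⟨A, hA⟩ : ∃ A : EuclideanSpace ℝ (Fin (D.dim j - 1)) →L[ℝ]
      EuclideanSpace ℝ (Fin (D.dim j - 1)),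
      HasMFDerivAt (𝓡 (D.dim j - 1)) (𝓡 (D.dim j - 1)) P ξ A :=
    ⟨_, ((hP.smooth.contMDiffAt (hP.isOpen.mem_nhds hP.mem)).mdifferentiableAt
      (by simp)).hasMFDerivAt⟩
  have hrankξ : rankIter (D.dim j - 1) P D.minDim ξ = r := by
    rw [← hrank ξ (mem_of_mem_nhds hW)]
    rw [rankIter_eq_of_map_eq hA hfix, rankIter_eq_of_map_eq hA hfix] at hstab ⊢
    exact Module.End.finrank_range_pow_eq _ hk hstab
  have hsemi := (hP.smooth.contMDiffAt_iterate hP.isOpen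
    (mem_iterDomain_of_map_eq hP.mem hfix D.minDim)).eventually_finrank_range_mfderiv_le
  obtain ⟨V, hVsub, hVo, hξV⟩ := mem_nhds_iff.1 (inter_mem (inter_mem hW (hdom D.minDim)) hsemi)
  have hVW : V ⊆ W := fun s hs => (hVsub hs).1.1
  have hVdom : V ⊆ iterDomain P U D.minDim := fun s hs => (hVsub hs).1.2
  -- The upper bound comes from `P^k` on `W`, the lower bound from semicontinuity at `ξ`.
  have hVrank : ∀ s ∈ V, rankIter (D.dim j - 1) P D.minDim s = r := fun s hs =>
    le_antisymm ((hP.smooth.rankIter_anti hP.isOpen hk (hVdom hs)).trans (hrank s (hVW hs)).le)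
      (hrankξ.ge.trans (hVsub hs).2)
  refine ⟨⟨V, hVo, hξV, hVW, hVdom, hVrank⟩, hF, hγ, hiso, hP, V, hVo, hξV, hVW.trans hWU, hVdom,
    fun s hs => ?_⟩
  rw [hVrank s hs, hrank ξ (mem_of_mem_nhds hW)]
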